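/- Let $(a;p)_n=\prod_{j=0}^{n-1}(1-ap^{j})$ and $(a;p)_\infty=\prod_{j\ge 0}(1-ap^{j})$. Define integers $M_{C1}(m,n)$ and $M_{C5}(m,n)$, for $m\in\mathbb{Z}$ and $n\ge 1$, as the coefficients of $z^m q^n$ in the following formal power series in $q$ with coefficients in $\mathbb{Z}[z,z^{-1}]$: $$\sum_{n=1}^{\infty}\sum_{m=-\infty}^{\infty}M_{C1}(m,n)z^{m}q^{n}=\frac{(q;q^{2})_{\infty}(q;q)_{\infty}}{(z;q)_{\infty}(z^{-1};q)_{\infty}}\sum_{n=1}^{\infty}\frac{q^{n}(z;q)_{n}(z^{-1};q)_{n}}{(q;q^{2})_{n}(q;q)_{n}}=\sum_{n=1}^{\infty}\frac{q^{n}(q^{2n+1};q^{2})_{\infty}(q^{n+1};q)_{\infty}}{(zq^{n};q)_{\infty}(z^{-1}q^{n};q)_{\infty}},$$ $$\sum_{n=1}^{\infty}\sum_{m=-\infty}^{\infty}M_{C5}(m,n)z^{m}q^{n}=\frac{(q;q^{2})_{\infty}(q;q)_{\infty}}{(z;q)_{\infty}(z^{-1};q)_{\infty}}\sum_{n=1}^{\infty}\frac{q^{\frac{n^{2}+n}{2}}(z;q)_{n}(z^{-1};q)_{n}}{(q;q^{2})_{n}(q;q)_{n}}=\sum_{n=1}^{\infty}\frac{q^{\frac{n^{2}+n}{2}}(q^{2n+1};q^{2})_{\infty}(q^{n+1};q)_{\infty}}{(zq^{n};q)_{\infty}(z^{-1}q^{n};q)_{\infty}}.$$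 Then $M_{C1}(m,n)\ge 0$ and $M_{C5}(m,n)\ge 0$ for all integers $m$ and all positive integers $n$. -/

import Mathlib

namespace SptCrank

open scoped LaurentPolynomial PowerSeries.WithPiTopology

/-- Coefficients in `ℤ[z, z⁻¹]` carry the discrete topology, so that infinite sums and products in
`ℤ[z, z⁻¹]⟦q⟧` converge exactly when every coefficient of `q ^ n` is eventually constant. -/
instance instTopologicalSpaceLaurent : TopologicalSpace ℤ[T;T⁻¹] := ⊥

instance instDiscreteTopologyLaurent : DiscreteTopology ℤ[T;T⁻¹] := ⟨rfl⟩

/-- The ring `ℤ[z, z⁻¹]⟦q⟧` of formal power series in `q` over the Laurent polynomials in `z`. -/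
abbrev ZQ : Type := PowerSeries ℤ[T;T⁻¹]

/-- The variable `q`. -/
noncomputable def q : ZQ := PowerSeries.X

/-- The variable `z`. -/
noncomputable def z : ZQ := PowerSeries.C (LaurentPolynomial.T 1)

/-- The inverse `z⁻¹` of the variable `z`. -/
noncomputable def zInv : ZQ := PowerSeries.C (LaurentPolynomial.T (-1))

/-- The finite `q`-shifted factorial `(a; p)_n = ∏_{0 ≤ j < n} (1 - a p ^ j)`. -/
noncomputable def qPoch (a p : ZQ) (n : ℕ) : ZQ :=
  ∏ j ∈ Finset.range n, (1 - a * p ^ j)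

/-- The infinite `q`-shifted factorial `(a; p)_∞ = ∏_{j ≥ 0} (1 - a p ^ j)`. -/
noncomputable def qPochInf (a p : ZQ) : ZQ :=
  ∏' j : ℕ, (1 - a * p ^ j)

/-- The reciprocal `1 / f` of a power series `f` with constant coefficient `1`. -/
noncomputable def recip (f : ZQ) : ZQ := PowerSeries.invOfUnit f 1

/-- The two-variable series
`∑_{n ≥ 1} q ^ e(n) (q ^ (2n+1); q²)_∞ (q ^ (n+1); q)_∞ / ((z q ^ n; q)_∞ (z⁻¹ q ^ n; q)_∞)`. -/
noncomputable def sptSeries (e : ℕ → ℕ) : ZQ :=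
  ∑' k : ℕ, let n := k + 1
    q ^ e n * (qPochInf (q ^ (2 * n + 1)) (q ^ 2) * qPochInf (q ^ (n + 1)) q) *
      recip (qPochInf (z * q ^ n) q * qPochInf (zInv * q ^ n) q)

/-- The spt-crank-type series `S_{C1}(z, q)`. -/
noncomputable def SC1 : ZQ := sptSeries fun n => n

/-- The spt-crank-type series `S_{C5}(z, q)`. -/
noncomputable def SC5 : ZQ := sptSeries fun n => n * (n + 1) / 2

/-- `M_{C1}(m, n)`, the coefficient of `z ^ m q ^ n` in `S_{C1}(z, q)`. -/
noncomputable def MC1 (m : ℤ) (n : ℕ) : ℤ := (PowerSeries.coeff n SC1).coeff m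

/-- `M_{C5}(m, n)`, the coefficient of `z ^ m q ^ n` in `S_{C5}(z, q)`. -/
noncomputable def MC5 (m : ℤ) (n : ℕ) : ℤ := (PowerSeries.coeff n SC5).coeff m

/-! The infinite products and sums above converge, and `sptSeries e` is the series
`(q; q²)_∞ (q; q)_∞ / ((z; q)_∞ (z⁻¹; q)_∞) ∑_{n ≥ 1} q ^ e(n) (z; q)_n (z⁻¹; q)_n /
((q; q²)_n (q; q)_n)`, with the denominator `(z; q)_∞ (z⁻¹; q)_∞`, which is not a unit, multiplied
out. -/

theorem X_pow_dvd_order {f : ZQ} {n : ℕ} (h : q ^ n ∣ f) : (n : ℕ∞) ≤ f.order :=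
  PowerSeries.le_order f n fun i hi => PowerSeries.X_pow_dvd_iff.mp h i (by exact_mod_cast hi)

theorem tendsto_order_of_dvd {f : ℕ → ZQ} (h : ∀ j, q ^ j ∣ f j) :
    Filter.Tendsto (fun j => (f j).order) Filter.atTop (nhds ⊤) := by
  refine ENat.tendsto_nhds_top_iff_natCast_lt.mpr fun n => Filter.eventually_atTop.mpr ⟨n + 1, ?_⟩
  intro m hm
  refine lt_of_lt_of_le ?_ (X_pow_dvd_order (h m))
  exact_mod_cast hm

theorem multipliable_qPoch (a : ZQ) {p : ZQ} (hp : q ∣ p) :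
    Multipliable fun j : ℕ => 1 - a * p ^ j := by
  simp_rw [sub_eq_add_neg]
  refine PowerSeries.WithPiTopology.multipliable_one_add_of_tendsto_order_atTop_nhds_top _
    (tendsto_order_of_dvd fun j => ?_)
  exact (dvd_neg.mpr ((pow_dvd_pow_of_dvd hp j).mul_left a))

theorem qPoch_mul_qPochInf (a : ZQ) {p : ZQ} (hp : q ∣ p) (n : ℕ) :
    qPoch a p n * qPochInf (a * p ^ n) p = qPochInf a p := by
  have h : (fun j : ℕ => 1 - a * p ^ n * p ^ j) = fun j : ℕ => 1 - a * p ^ (j + n) := by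
    funext j; ring
  have hm := multipliable_qPoch (a * p ^ n) hp
  rw [h] at hm
  have := Multipliable.prod_mul_tprod_nat_mul' (f := fun j : ℕ => 1 - a * p ^ j) (k := n) hm
  rw [qPoch, qPochInf, qPochInf, h]
  exact this

theorem constantCoeff_qPochInf {a p : ZQ} (ha : q ∣ a) (hp : q ∣ p) :
    PowerSeries.constantCoeff (qPochInf a p) = 1 := by
  have ha' : PowerSeries.constantCoeff a = 0 := PowerSeries.X_dvd_iff.mp ha
  rw [qPochInf, (multipliable_qPoch a hp).map_tprod _
    (PowerSeries.WithPiTopology.continuous_constantCoeff _)]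
  simp [ha']

theorem constantCoeff_qPoch {a : ZQ} (p : ZQ) (ha : q ∣ a) (n : ℕ) :
    PowerSeries.constantCoeff (qPoch a p n) = 1 := by
  have ha' : PowerSeries.constantCoeff a = 0 := PowerSeries.X_dvd_iff.mp ha
  simp [qPoch, ha']

theorem mul_recip {f : ZQ} (h : PowerSeries.constantCoeff f = 1) : f * recip f = 1 :=
  PowerSeries.mul_invOfUnit f 1 (by simpa using h)

theorem summable_of_dvd {f : ℕ → ZQ} (h : ∀ j, q ^ j ∣ f j) : Summable f :=
  PowerSeries.WithPiTopology.summable_of_tendsto_order_atTop_nhds_top _ (tendsto_order_of_dvd h)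

theorem sptSeries_spec (e : ℕ → ℕ) (he : ∀ n, n ≤ e n) :
    qPochInf z q * qPochInf zInv q * sptSeries e =
      qPochInf q (q ^ 2) * qPochInf q q *
        ∑' k : ℕ, let n := k + 1
          q ^ e n * (qPoch z q n * qPoch zInv q n) * recip (qPoch q (q ^ 2) n * qPoch q q n) := by
  have hq2 : q ∣ q ^ 2 := dvd_pow_self q two_ne_zero
  have hd (k : ℕ) : q ^ k ∣ q ^ e (k + 1) := pow_dvd_pow q ((Nat.le_succ k).trans (he (k + 1)))
  rw [sptSeries, ← Summable.tsum_mul_left, ← Summable.tsum_mul_left]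
  · refine tsum_congr fun k => ?_
    dsimp only
    set n := k + 1 with hn
    have hqn : q ∣ q ^ n := dvd_pow_self q (by omega)
    have h1 := mul_recip (f := qPochInf (z * q ^ n) q * qPochInf (zInv * q ^ n) q) (by
      rw [map_mul, constantCoeff_qPochInf (hqn.mul_left _) dvd_rfl,
        constantCoeff_qPochInf (hqn.mul_left _) dvd_rfl, one_mul])
    have h2 := mul_recip (f := qPoch q (q ^ 2) n * qPoch q q n) (by
      rw [map_mul, constantCoeff_qPoch _ dvd_rfl, constantCoeff_qPoch _ dvd_rfl, one_mul])
    have e1 := qPoch_mul_qPochInf z (dvd_refl q) n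
    have e2 := qPoch_mul_qPochInf zInv (dvd_refl q) n
    have e3 := qPoch_mul_qPochInf q hq2 n
    have e4 := qPoch_mul_qPochInf q (dvd_refl q) n
    rw [show q * (q ^ 2) ^ n = q ^ (2 * n + 1) by ring] at e3
    rw [show q * q ^ n = q ^ (n + 1) by ring] at e4
    rw [← e1, ← e2, ← e3, ← e4]
    generalize recip (qPochInf (z * q ^ n) q * qPochInf (zInv * q ^ n) q) = r1 at *
    generalize recip (qPoch q (q ^ 2) n * qPoch q q n) = r2 at *
    calc _ = (qPochInf (z * q ^ n) q * qPochInf (zInv * q ^ n) q * r1) *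
          (qPoch z q n * qPoch zInv q n * q ^ e n *
            (qPochInf (q ^ (2 * n + 1)) (q ^ 2) * qPochInf (q ^ (n + 1)) q)) := by ring
      _ = (qPoch q (q ^ 2) n * qPoch q q n * r2) *
          (qPoch z q n * qPoch zInv q n * q ^ e n *
            (qPochInf (q ^ (2 * n + 1)) (q ^ 2) * qPochInf (q ^ (n + 1)) q)) := by rw [h1, h2]
      _ = _ := by ring
  · exact summable_of_dvd fun k => ((hd k).mul_right _).mul_right _
  · exact summable_of_dvd fun k => ((hd k).mul_right _).mul_right _

end SptCrank

/-! Both series come from Bailey's lemma relative to `1` with parameters `z, z⁻¹`. The sequences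
`β_n = 1/((q;q²)_n (q;q)_n)` and `q^(n(n-1)/2) β_n` belong to Bailey pairs whose `α` is supported on
even indices. Multiplying by `(q²;q²)_∞` turns the prefactor into `(q;q)_∞²`, and each `α_r` with `r
≥ 1` then contributes `α_r q^r / ((1 - z q^r)(1 - z⁻¹ q^r))`. The index `r = 0` would give a pole at
`z = 1`. It is removed by subtracting the unit Bailey pair, whose `β_n` vanishes for `n ≥ 1` and
whose `α_0` is also `1`.

Since `(1 + q^r) / ((1 - z q^r)(1 - z⁻¹ q^r)) = (1 - q^r)⁻¹ ∑_m z^m q^(r|m|)`, the coefficient of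
`z^m` is a signed sum of terms `q^E / (1 - q^r)`. These are sorted into groups indexed by `l`
(`sum_regroup`), whose negative terms have denominator `1 - q^(2(2l+1))` or `1 - q^(4(l+1))`.
Splitting the positive term over `1 - q^(2l+1)` by the parity of the exponent's multiple of `2l+1`
lets differences of geometric series collapse to finite sums. For `C5` everything left is positive.
For `C1`, `l + 1` negative monomials remain; each is paired with a positive monomial of smaller or
equal even exponent, and the difference is divisible by `1 - q²`, which the factor `1/(q²;q²)_∞`
absorbs.

Infinite sums are never rearranged: all identities are finite, and limits are replaced by
congruences modulo powers of `q`. -/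

namespace SptCrank

open scoped LaurentPolynomial PowerSeries.WithPiTopology

/-! ### Bailey pairs relative to `1`, over an arbitrary commutative ring -/

section BaileyPairs

variable {R : Type*} [CommRing R]

/-- `I (n - k)`, with the value `0` when `n < k`. -/
def shiftBy (I : ℕ → R) (n k : ℕ) : R := if k ≤ n then I (n - k) else 0

theorem shiftBy_of_lt {I : ℕ → R} {n k : ℕ} (h : n < k) : shiftBy I n k = 0 :=
  if_neg (by omega)

theorem shiftBy_add (I : ℕ → R) (n k : ℕ) : shiftBy I (n + k) k = I n := by
  simp [shiftBy]

theorem shiftBy_zero (I : ℕ → R) (n : ℕ) : shiftBy I n 0 = I n := by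
  simp [shiftBy]

/-- A function that behaves like `k ↦ 1 / (x; x)_k`. -/
def IsInvFactorial (x : R) (I : ℕ → R) : Prop :=
  I 0 = 1 ∧ ∀ k, I k = (1 - x ^ (k + 1)) * I (k + 1)

/-- The coefficient sequence of the unit Bailey pair relative to `1`. -/
def unitAlpha (x : R) (r : ℕ) : R :=
  if r = 0 then 1 else (-1) ^ r * x ^ (r * (r - 1) / 2) * (1 + x ^ r)

/-- The even-indexed terms of the Bailey pair with
`β_n = 1 / ((x; x²)_n (x; x)_n)` relative to `1`. -/
def cOneAlpha (x : R) (r : ℕ) : R :=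
  if r = 0 then 1 else (-1) ^ r * x ^ (r * (3 * r - 1)) * (1 + x ^ (2 * r))

/-- The even-indexed terms of the Bailey pair with
`β_n = x ^ (n (n - 1) / 2) / ((x; x²)_n (x; x)_n)` relative to `1`. -/
def cFiveAlpha (x : R) (r : ℕ) : R :=
  if r = 0 then 1 else (-1) ^ r * x ^ (r * (r - 1)) * (1 + x ^ (2 * r))

variable {x : R} {I : ℕ → R}

/-- Truncating the `r`-sum at any `R` leaves a closed form, so induction on `R` proves it. The right
side vanishes once `R > n`, which gives the Bailey relation for the unit pair. -/
theorem unitAlpha_partial_sum (hI : IsInvFactorial x I) (n R : ℕ) :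
    (1 - x ^ (n + 1)) * ∑ r ∈ Finset.range (R + 1),
        unitAlpha x r * (shiftBy I (n + 1) r * I (n + 1 + r)) =
      (-1) ^ R * x ^ (R * (R + 1) / 2) * (shiftBy I n R * I (n + 1 + R)) := by
  induction R with
  | zero =>
    simp only [zero_add, Finset.sum_range_one, unitAlpha, shiftBy_zero, if_true]
    rw [hI.2 n]; simp; ring
  | succ R ih =>
    rw [Finset.sum_range_succ, mul_add, ih]
    have hu : unitAlpha x (R + 1) =
        (-1) ^ (R + 1) * x ^ (R * (R + 1) / 2) * (1 + x ^ (R + 1)) := by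
      simp [unitAlpha, Nat.mul_comm]
    have he : (R + 1) * (R + 1 + 1) / 2 = R * (R + 1) / 2 + (R + 1) := by
      rw [show (R + 1) * (R + 1 + 1) = R * (R + 1) + (R + 1) * 2 by ring,
        Nat.add_mul_div_right _ _ two_pos]
    rw [hu, he]
    rcases lt_or_ge n R with h | h
    · rw [shiftBy_of_lt h, shiftBy_of_lt (show n < R + 1 by omega),
        shiftBy_of_lt (show n + 1 < R + 1 by omega)]
      simp
    obtain ⟨k, rfl⟩ := Nat.exists_eq_add_of_le' h
    rw [shiftBy_add, show k + R + 1 = k + (R + 1) by ring, shiftBy_add]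
    have h2 := hI.2 (k + (R + 1) + R)
    rw [show k + (R + 1) + (R + 1) = k + (R + 1) + R + 1 by ring, h2]
    generalize I (k + (R + 1) + R + 1) = v
    rcases k with _ | k
    · rw [shiftBy_of_lt (by omega)]
      simp only [hI.1]; ring
    · rw [show k + 1 + R = k + (R + 1) by ring, shiftBy_add, hI.2 k]
      ring

theorem unitAlpha_sum (hI : IsInvFactorial x I) (hx : ∀ k, IsUnit (1 - x ^ (k + 1))) {n N : ℕ}
    (hn : 1 ≤ n) (hN : n ≤ N) :
    ∑ r ∈ Finset.range (N + 1), unitAlpha x r * (shiftBy I n r * I (n + r)) = 0 := by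
  obtain ⟨n, rfl⟩ := Nat.exists_eq_add_of_le' hn
  refine (hx n).mul_left_cancel ?_
  rw [unitAlpha_partial_sum hI, shiftBy_of_lt (by omega)]
  simp

/-- The expected `β_n` satisfies `(1 - x^(n+1))(1 - x^(2n+1)) β_(n+1) = β_n`. The defect of this
recurrence, summed over `r`, telescopes to a boundary term that vanishes for `2R ≥ n`. -/
theorem cOneAlpha_partial_sum (hI : IsInvFactorial x I) (n R : ℕ) :
    ∑ r ∈ Finset.range (R + 1), cOneAlpha x r *
        ((1 - x ^ (n + 1)) * (1 - x ^ (2 * n + 1)) *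
            (shiftBy I (n + 1) (2 * r) * I (n + 1 + 2 * r)) -
          shiftBy I n (2 * r) * I (n + 2 * r)) =
      (-1) ^ R * x ^ (n + 1 + 3 * (R * (R + 1))) *
        (shiftBy I n (2 * R + 1) * I (n + 1 + 2 * R)) := by
  induction R with
  | zero =>
    simp only [zero_add, Finset.sum_range_one, cOneAlpha, shiftBy_zero, if_true, mul_zero]
    rcases n with _ | n
    · rw [shiftBy_of_lt (by omega)]
      simp only [hI.1, zero_add, add_zero]
      have := hI.2 0
      rw [hI.1] at this
      simp only [zero_add, mul_zero] at this ⊢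
      linear_combination (-(1 - x ^ 1) * I 1 - 1) * this
    · rw [shiftBy_add]
      simp only [add_zero]
      rw [hI.2 n, hI.2 (n + 1)]
      ring
  | succ R ih =>
    rw [Finset.sum_range_succ, ih]
    have hu : cOneAlpha x (R + 1) =
        (-1) ^ (R + 1) * x ^ ((R + 1) * (3 * R + 2)) * (1 + x ^ (2 * (R + 1))) := by
      simp only [cOneAlpha, Nat.succ_ne_zero, if_false]
      rw [show 3 * (R + 1) - 1 = 3 * R + 2 by omega]
    rw [hu]
    rcases lt_or_ge n (2 * R + 1) with h | h
    · rw [shiftBy_of_lt h, shiftBy_of_lt (show n < 2 * (R + 1) by omega),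
        shiftBy_of_lt (show n + 1 < 2 * (R + 1) by omega),
        shiftBy_of_lt (show n < 2 * (R + 1) + 1 by omega)]
      simp
    obtain ⟨k, rfl⟩ := Nat.exists_eq_add_of_le' h
    rw [shiftBy_add, show k + (2 * R + 1) + 1 = k + 2 * (R + 1) by ring, shiftBy_add]
    rw [show k + 2 * (R + 1) + 2 * R = k + 4 * R + 2 by ring,
      show k + 2 * (R + 1) + 2 * (R + 1) = k + 4 * R + 4 by ring,
      show k + (2 * R + 1) + 2 * (R + 1) = k + 4 * R + 3 by ring, hI.2 (k + 4 * R + 2),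
      hI.2 (k + 4 * R + 3)]
    generalize I (k + 4 * R + 3 + 1) = v
    -- With `n = k + 2R + 1`, the factors reduce to `I k`, `I (k - 1)` and `I (k - 2)`; the cases `k
    -- = 0, 1` are those where some of them are zero by convention.
    rcases k with _ | _ | k
    · rw [shiftBy_of_lt (by omega), shiftBy_of_lt (by omega)]
      simp only [hI.1]; ring
    · rw [shiftBy_of_lt (show 0 + 1 + (2 * R + 1) < 2 * (R + 1) + 1 by omega),
        show 0 + 1 + (2 * R + 1) = 0 + 2 * (R + 1) by ring, shiftBy_add, hI.2 0]
      simp only [zero_add]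
      ring
    · rw [show k + 1 + 1 + (2 * R + 1) = k + (2 * (R + 1) + 1) by ring, shiftBy_add,
        show k + (2 * (R + 1) + 1) = k + 1 + 2 * (R + 1) by ring, shiftBy_add, hI.2 k,
        hI.2 (k + 1)]
      ring

/-- The same telescoping, for the recurrence `(1 - x^(n+1))(1 - x^(2n+1)) β_(n+1) = x^n β_n`. -/
theorem cFiveAlpha_partial_sum (hI : IsInvFactorial x I) (n R : ℕ) :
    ∑ r ∈ Finset.range (R + 1), cFiveAlpha x r *
        ((1 - x ^ (n + 1)) * (1 - x ^ (2 * n + 1)) *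
            (shiftBy I (n + 1) (2 * r) * I (n + 1 + 2 * r)) -
          x ^ n * (shiftBy I n (2 * r) * I (n + 2 * r))) =
      (-1) ^ R * x ^ (R * (R + 1)) * (shiftBy I n (2 * R + 1) * I (n + 1 + 2 * R)) := by
  induction R with
  | zero =>
    simp only [zero_add, Finset.sum_range_one, cFiveAlpha, shiftBy_zero, if_true, mul_zero]
    rcases n with _ | n
    · rw [shiftBy_of_lt (by omega)]
      simp only [hI.1, zero_add, add_zero]
      have := hI.2 0
      rw [hI.1] at this
      simp only [zero_add, mul_zero] at this ⊢
      linear_combination (-(1 - x ^ 1) * I 1 - 1) * this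
    · rw [shiftBy_add]
      simp only [add_zero]
      rw [hI.2 n, hI.2 (n + 1)]
      ring
  | succ R ih =>
    rw [Finset.sum_range_succ, ih]
    have hu : cFiveAlpha x (R + 1) =
        (-1) ^ (R + 1) * x ^ ((R + 1) * R) * (1 + x ^ (2 * (R + 1))) := by
      simp [cFiveAlpha]
    rw [hu]
    rcases lt_or_ge n (2 * R + 1) with h | h
    · rw [shiftBy_of_lt h, shiftBy_of_lt (show n < 2 * (R + 1) by omega),
        shiftBy_of_lt (show n + 1 < 2 * (R + 1) by omega),
        shiftBy_of_lt (show n < 2 * (R + 1) + 1 by omega)]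
      simp
    obtain ⟨k, rfl⟩ := Nat.exists_eq_add_of_le' h
    rw [shiftBy_add, show k + (2 * R + 1) + 1 = k + 2 * (R + 1) by ring, shiftBy_add]
    rw [show k + 2 * (R + 1) + 2 * R = k + 4 * R + 2 by ring,
      show k + 2 * (R + 1) + 2 * (R + 1) = k + 4 * R + 4 by ring,
      show k + (2 * R + 1) + 2 * (R + 1) = k + 4 * R + 3 by ring, hI.2 (k + 4 * R + 2),
      hI.2 (k + 4 * R + 3)]
    generalize I (k + 4 * R + 3 + 1) = v
    rcases k with _ | _ | k
    · rw [shiftBy_of_lt (by omega), shiftBy_of_lt (by omega)]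
      simp only [hI.1]; ring
    · rw [shiftBy_of_lt (show 0 + 1 + (2 * R + 1) < 2 * (R + 1) + 1 by omega),
        show 0 + 1 + (2 * R + 1) = 0 + 2 * (R + 1) by ring, shiftBy_add, hI.2 0]
      simp only [zero_add]
      ring
    · rw [show k + 1 + 1 + (2 * R + 1) = k + (2 * (R + 1) + 1) by ring, shiftBy_add,
        show k + (2 * (R + 1) + 1) = k + 1 + 2 * (R + 1) by ring, shiftBy_add, hI.2 k,
        hI.2 (k + 1)]
      ring

/-- A function that behaves like `k ↦ 1 / (x; x²)_k`. -/
def IsInvOddFactorial (x : R) (O : ℕ → R) : Prop :=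
  O 0 = 1 ∧ ∀ k, O k = (1 - x ^ (2 * k + 1)) * O (k + 1)

theorem sum_alpha_mul_shiftBy_zero (hI : IsInvFactorial x I) {A : ℕ → R} (hA : A 0 = 1) (M : ℕ) :
    ∑ r ∈ Finset.range (M + 1), A r * (shiftBy I 0 (2 * r) * I (0 + 2 * r)) = 1 := by
  rw [Finset.sum_range_succ', Finset.sum_eq_zero]
  · simp [shiftBy_zero, hI.1, hA]
  · intro r _
    rw [shiftBy_of_lt (by omega)]
    simp

theorem cOneAlpha_sum (hI : IsInvFactorial x I) {O : ℕ → R} (hO : IsInvOddFactorial x O)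
    (hx : ∀ k, IsUnit (1 - x ^ (k + 1))) (M : ℕ) {n : ℕ} (hn : n ≤ 2 * M) :
    ∑ r ∈ Finset.range (M + 1), cOneAlpha x r * (shiftBy I n (2 * r) * I (n + 2 * r)) =
      O n * I n := by
  induction n with
  | zero => rw [sum_alpha_mul_shiftBy_zero hI (by simp [cOneAlpha]), hI.1, hO.1, one_mul]
  | succ n ih =>
    have h := cOneAlpha_partial_sum hI n M
    rw [shiftBy_of_lt (by omega), zero_mul, mul_zero] at h
    generalize hc : (1 - x ^ (n + 1)) * (1 - x ^ (2 * n + 1)) = c at h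
    simp_rw [mul_sub, mul_left_comm _ c] at h
    rw [Finset.sum_sub_distrib, ← Finset.mul_sum, ih (by omega), hI.2 n, hO.2 n, ← hc] at h
    refine ((hx n).mul (hx (2 * n))).mul_left_cancel ?_
    linear_combination h

theorem cFiveAlpha_sum (hI : IsInvFactorial x I) {O : ℕ → R} (hO : IsInvOddFactorial x O)
    (hx : ∀ k, IsUnit (1 - x ^ (k + 1))) (M : ℕ) {n : ℕ} (hn : n ≤ 2 * M) :
    ∑ r ∈ Finset.range (M + 1), cFiveAlpha x r * (shiftBy I n (2 * r) * I (n + 2 * r)) =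
      x ^ (n * (n - 1) / 2) * (O n * I n) := by
  induction n with
  | zero => rw [sum_alpha_mul_shiftBy_zero hI (by simp [cFiveAlpha]), hI.1, hO.1]; simp
  | succ n ih =>
    have h := cFiveAlpha_partial_sum hI n M
    rw [shiftBy_of_lt (by omega), zero_mul, mul_zero] at h
    generalize hc : (1 - x ^ (n + 1)) * (1 - x ^ (2 * n + 1)) = c at h
    simp_rw [mul_sub, mul_left_comm _ c, mul_left_comm _ (x ^ n)] at h
    rw [Finset.sum_sub_distrib, ← Finset.mul_sum, ← Finset.mul_sum, ih (by omega), hI.2 n,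
      hO.2 n, ← hc] at h
    refine ((hx n).mul (hx (2 * n))).mul_left_cancel ?_
    have he : (n + 1) * (n + 1 - 1) / 2 = n + n * (n - 1) / 2 := by
      rw [Nat.add_sub_cancel]
      rcases n with _ | n
      · rfl
      · rw [Nat.add_sub_cancel,
          show (n + 1 + 1) * (n + 1) = (n + 1) * n + (n + 1) * 2 by ring,
          Nat.add_mul_div_right _ _ two_pos, add_comm]
    rw [he, pow_add]
    linear_combination h

/-- A telescoping evaluation equivalent to the `q`-Gauss sum with parameters `z, z⁻¹`. -/
theorem telescoping_sum (hI : IsInvFactorial x I) {z w : R} (hzw : z * w = 1) {T : ℕ → R}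
    (hT : ∀ n, T (n + 1 + 1) = (1 - z * x ^ (n + 1)) * (1 - w * x ^ (n + 1)) * T (n + 1))
    {r : ℕ} (hr : 1 ≤ r) (N : ℕ) :
    (1 - z * x ^ r) * (1 - w * x ^ r) * ∑ n ∈ Finset.range N,
        x ^ (n + 1) * T (n + 1) * (shiftBy I (n + 1) r * I (n + 1 + r)) =
      x ^ r * (T (N + 1) * (shiftBy I N r * I (N + r))) := by
  induction N with
  | zero => rw [shiftBy_of_lt (by omega)]; simp
  | succ N ih =>
    -- With `z w = 1` the inductive step is `x^(N+1) (1 - z x^r)(1 - w x^r) + x^r (1 - x^(N+1-r))(1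
    -- - x^(N+1+r)) = x^r (1 - z x^(N+1))(1 - w x^(N+1))`.
    rw [Finset.sum_range_succ, mul_add, ih, hT N]
    rcases lt_or_ge (N + 1) r with h | h
    · rw [shiftBy_of_lt h, shiftBy_of_lt (by omega)]
      simp
    obtain ⟨k, hk⟩ := Nat.exists_eq_add_of_le' h
    rw [show N + 1 + r = N + r + 1 by ring, hI.2 (N + r), hk, shiftBy_add]
    rcases k with _ | k
    · rw [shiftBy_of_lt (by omega), show N + r + 1 = 2 * r by omega, zero_add]
      ring
    · rw [show N = k + r by omega, shiftBy_add, hI.2 k]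
      linear_combination (x ^ (3 * r + k + 1) * (1 - x ^ (k + 1)) *
        (T (k + 1 + r) * I (k + 1) * I (k + r + r + 1))) * hzw

end BaileyPairs

/-! ### Congruences modulo powers of `q`, and `q`-products -/

/-- Closedness of a congruence class is what carries congruences from finite products and sums to
infinite ones. -/
theorem isClosed_dvd_sub (j : ℕ) (c : ZQ) : IsClosed {f : ZQ | q ^ j ∣ f - c} := by
  have : {f : ZQ | q ^ j ∣ f - c} =
      ⋂ i : ℕ, ⋂ _ : i < j, {f : ZQ | PowerSeries.coeff i f = PowerSeries.coeff i c} := by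
    ext f
    simp [q, PowerSeries.X_pow_dvd_iff, sub_eq_zero]
  rw [this]
  refine isClosed_iInter fun i => isClosed_iInter fun _ => ?_
  exact isClosed_eq (PowerSeries.WithPiTopology.continuous_coeff _ i) continuous_const

theorem dvd_mul_sub_one {d a b : ZQ} (ha : d ∣ a - 1) (hb : d ∣ b - 1) : d ∣ a * b - 1 := by
  have : a * b - 1 = a * (b - 1) + (a - 1) := by ring
  rw [this]
  exact dvd_add (hb.mul_left _) ha

theorem dvd_qPochInf_sub_one {a p : ZQ} {j : ℕ} (ha : q ^ j ∣ a) (hp : q ∣ p) :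
    q ^ j ∣ qPochInf a p - 1 := by
  refine (isClosed_dvd_sub j 1).mem_of_tendsto (multipliable_qPoch a hp).hasProd
    (Filter.Eventually.of_forall fun s => ?_)
  refine Finset.prod_induction _ (fun f => q ^ j ∣ f - 1) (fun _ _ => dvd_mul_sub_one) (by simp)
    fun i _ => ?_
  have : 1 - a * p ^ i - 1 = -(a * p ^ i) := by ring
  rw [this]
  exact dvd_neg.mpr (ha.mul_right _)

theorem dvd_tsum {f : ℕ → ZQ} {j : ℕ} (hf : Summable f) (h : ∀ k, q ^ j ∣ f k) :
    q ^ j ∣ ∑' k, f k := by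
  have := (isClosed_dvd_sub j 0).mem_of_tendsto hf.hasSum
    (Filter.Eventually.of_forall fun s => by
      simpa using Finset.dvd_sum fun k _ => h k)
  simpa using this

theorem eq_recip {f g : ZQ} (hf : PowerSeries.constantCoeff f = 1) (h : f * g = 1) :
    g = recip f := by
  have := mul_recip hf
  calc g = g * (f * recip f) := by rw [this, mul_one]
    _ = (f * g) * recip f := by ring
    _ = recip f := by rw [h, one_mul]

theorem isUnit_of_constantCoeff {f : ZQ} (h : PowerSeries.constantCoeff f = 1) : IsUnit f :=
  IsUnit.of_mul_eq_one _ (mul_recip h)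

theorem q_dvd_q_pow_succ (k : ℕ) : q ∣ q ^ (k + 1) := dvd_pow_self q k.succ_ne_zero

theorem constantCoeff_q : PowerSeries.constantCoeff q = 0 := by simp [q]

theorem isUnit_one_sub_q_pow (k : ℕ) : IsUnit (1 - q ^ (k + 1)) :=
  isUnit_of_constantCoeff (by simp [constantCoeff_q])

/-- `1 / (q; q)_k`. -/
noncomputable def invFactorial (k : ℕ) : ZQ := recip (qPoch q q k)

/-- `1 / (q; q²)_k`. -/
noncomputable def invOddFactorial (k : ℕ) : ZQ := recip (qPoch q (q ^ 2) k)

theorem qPoch_mul_invFactorial (k : ℕ) : qPoch q q k * invFactorial k = 1 :=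
  mul_recip (constantCoeff_qPoch _ dvd_rfl _)

theorem qPoch_mul_invOddFactorial (k : ℕ) : qPoch q (q ^ 2) k * invOddFactorial k = 1 :=
  mul_recip (constantCoeff_qPoch _ dvd_rfl _)

theorem isInvFactorial_invFactorial : IsInvFactorial q invFactorial := by
  refine ⟨?_, fun k => ?_⟩
  · simpa [qPoch] using qPoch_mul_invFactorial 0
  · symm
    refine eq_recip (constantCoeff_qPoch _ dvd_rfl _) ?_
    have := qPoch_mul_invFactorial (k + 1)
    rw [qPoch, Finset.prod_range_succ, ← qPoch] at this
    linear_combination this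

theorem isInvOddFactorial_invOddFactorial : IsInvOddFactorial q invOddFactorial := by
  refine ⟨?_, fun k => ?_⟩
  · simpa [qPoch] using qPoch_mul_invOddFactorial 0
  · symm
    refine eq_recip (constantCoeff_qPoch _ dvd_rfl _) ?_
    have := qPoch_mul_invOddFactorial (k + 1)
    rw [qPoch, Finset.prod_range_succ, ← qPoch] at this
    linear_combination this

theorem qPochInf_mul_invFactorial (k : ℕ) :
    qPochInf q q * invFactorial k = qPochInf (q ^ (k + 1)) q := by
  have := qPoch_mul_qPochInf q (dvd_refl q) k
  rw [show q * q ^ k = q ^ (k + 1) by ring] at this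
  rw [← this]
  linear_combination qPochInf (q ^ (k + 1)) q * qPoch_mul_invFactorial k

theorem qPochInf_mul_invOddFactorial (k : ℕ) :
    qPochInf q (q ^ 2) * invOddFactorial k = qPochInf (q ^ (2 * k + 1)) (q ^ 2) := by
  have := qPoch_mul_qPochInf q (dvd_pow_self q two_ne_zero) k
  rw [show q * (q ^ 2) ^ k = q ^ (2 * k + 1) by ring] at this
  rw [← this]
  linear_combination qPochInf (q ^ (2 * k + 1)) (q ^ 2) * qPoch_mul_invOddFactorial k

theorem qPochInf_odd_mul_even : qPochInf q (q ^ 2) * qPochInf (q ^ 2) (q ^ 2) = qPochInf q q := by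
  have hq2 : q ∣ q ^ 2 := dvd_pow_self q two_ne_zero
  have h1 : (fun k : ℕ => 1 - q * (q ^ 2) ^ k) = fun k => 1 - q * q ^ (2 * k) := by
    funext k; ring
  have h2 : (fun k : ℕ => 1 - q ^ 2 * (q ^ 2) ^ k) = fun k => 1 - q * q ^ (2 * k + 1) := by
    funext k; ring
  have m1 := multipliable_qPoch q hq2
  have m2 := multipliable_qPoch (q ^ 2) hq2
  rw [h1] at m1
  rw [h2] at m2
  rw [qPochInf, qPochInf, qPochInf, h1, h2]
  exact tprod_even_mul_odd (f := fun k : ℕ => 1 - q * q ^ k) m1 m2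

/-! ### Bailey's lemma with parameters `z, z⁻¹`, in truncated form -/

/-- `(q; q)_∞² / ((z qⁿ; q)_∞ (z⁻¹ qⁿ; q)_∞)`. -/
noncomputable def crankTail (n : ℕ) : ZQ :=
  qPochInf q q ^ 2 * recip (qPochInf (z * q ^ n) q * qPochInf (zInv * q ^ n) q)

theorem z_mul_zInv : z * zInv = 1 := by
  rw [z, zInv, ← map_mul, ← LaurentPolynomial.T_add]
  simp

theorem constantCoeff_tail (n : ℕ) : PowerSeries.constantCoeff
    (qPochInf (z * q ^ (n + 1)) q * qPochInf (zInv * q ^ (n + 1)) q) = 1 := by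
  rw [map_mul, constantCoeff_qPochInf ((q_dvd_q_pow_succ n).mul_left _) dvd_rfl,
    constantCoeff_qPochInf ((q_dvd_q_pow_succ n).mul_left _) dvd_rfl, one_mul]

theorem crankTail_succ (n : ℕ) : crankTail (n + 1 + 1) =
    (1 - z * q ^ (n + 1)) * (1 - zInv * q ^ (n + 1)) * crankTail (n + 1) := by
  have h1 := qPoch_mul_qPochInf (z * q ^ (n + 1)) (dvd_refl q) 1
  have h2 := qPoch_mul_qPochInf (zInv * q ^ (n + 1)) (dvd_refl q) 1
  simp only [qPoch, Finset.prod_range_one, pow_zero, mul_one, pow_one] at h1 h2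
  rw [show z * q ^ (n + 1) * q = z * q ^ (n + 1 + 1) by ring] at h1
  rw [show zInv * q ^ (n + 1) * q = zInv * q ^ (n + 1 + 1) by ring] at h2
  rw [crankTail, crankTail, ← eq_recip (constantCoeff_tail (n + 1))
    (g := (1 - z * q ^ (n + 1)) * (1 - zInv * q ^ (n + 1)) *
      recip (qPochInf (z * q ^ (n + 1)) q * qPochInf (zInv * q ^ (n + 1)) q))]
  · ring
  · refine Eq.trans ?_ (mul_recip (constantCoeff_tail n))
    generalize recip (qPochInf (z * q ^ (n + 1)) q * qPochInf (zInv * q ^ (n + 1)) q) = v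
    rw [← h1, ← h2]
    ring

/-- `1 / ((1 - z qʳ) (1 - z⁻¹ qʳ))`. -/
noncomputable def poleTerm (r : ℕ) : ZQ := recip ((1 - z * q ^ r) * (1 - zInv * q ^ r))

theorem mul_poleTerm {r : ℕ} (hr : 1 ≤ r) :
    (1 - z * q ^ r) * (1 - zInv * q ^ r) * poleTerm r = 1 :=
  mul_recip (by simp [constantCoeff_q, zero_pow (by omega : r ≠ 0)])

/-- The product equals `(q^(N-r+1);q)_∞ (q^(N+r+1);q)_∞ / ((z q^(N+1);q)_∞ (z⁻¹ q^(N+1);q)_∞)`, and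
every factor is `1` modulo `q^(N+1-r)`. -/
theorem dvd_crankTail_sub_one {r N : ℕ} (hr : r ≤ N) :
    q ^ (N + 1 - r) ∣ crankTail (N + 1) * (invFactorial (N - r) * invFactorial (N + r)) - 1 := by
  have hd {k : ℕ} (hk : N - r ≤ k) : q ^ (N + 1 - r) ∣ q ^ (k + 1) := pow_dvd_pow q (by omega)
  have h1 := dvd_qPochInf_sub_one (hd le_rfl) (dvd_refl q)
  have h2 := dvd_qPochInf_sub_one (hd (k := N + r) (by omega)) (dvd_refl q)
  have h3 := dvd_qPochInf_sub_one ((hd (k := N) (by omega)).mul_left z) (dvd_refl q)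
  have h4 := dvd_qPochInf_sub_one ((hd (k := N) (by omega)).mul_left zInv) (dvd_refl q)
  have h5 := dvd_mul_sub_one h3 h4
  have h6 := mul_recip (constantCoeff_tail N)
  have h7 : q ^ (N + 1 - r) ∣
      recip (qPochInf (z * q ^ (N + 1)) q * qPochInf (zInv * q ^ (N + 1)) q) - 1 := by
    refine (dvd_neg.mpr (h5.mul_right
      (recip (qPochInf (z * q ^ (N + 1)) q * qPochInf (zInv * q ^ (N + 1)) q)))).trans ?_
    rw [sub_mul, h6]
    simp
  have := dvd_mul_sub_one h7 (dvd_mul_sub_one h1 h2)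
  rw [← qPochInf_mul_invFactorial, ← qPochInf_mul_invFactorial] at this
  convert this using 2
  rw [crankTail]
  ring

/-- This replaces the limit `N → ∞` of `telescoping_sum`; the factor `q^r` there raises the
precision from `q^(N+1-r)` to `q^(N+1)`. -/
theorem dvd_sum_crankTail_sub {r N : ℕ} (hr : 1 ≤ r) (hN : r ≤ N) :
    q ^ (N + 1) ∣ ∑ n ∈ Finset.range N, q ^ (n + 1) * crankTail (n + 1) *
        (shiftBy invFactorial (n + 1) r * invFactorial (n + 1 + r)) - q ^ r * poleTerm r := by
  have h := telescoping_sum isInvFactorial_invFactorial z_mul_zInv crankTail_succ hr N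
  obtain ⟨c, hc⟩ := dvd_crankTail_sub_one hN
  rw [← Nat.sub_add_cancel hN, shiftBy_add, Nat.sub_add_cancel hN] at h
  refine ⟨poleTerm r * c, ?_⟩
  have hp := mul_poleTerm hr
  have hq : q ^ (N + 1) = q ^ r * q ^ (N + 1 - r) := by rw [← pow_add]; congr 1; omega
  rw [hq]
  linear_combination poleTerm r * h + poleTerm r * q ^ r * hc - (∑ n ∈ Finset.range N,
    q ^ (n + 1) * crankTail (n + 1) *
      (shiftBy invFactorial (n + 1) r * invFactorial (n + 1 + r))) * hp

/-- The `n`-th summand of `sptSeries e`. -/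
noncomputable def sptTerm (e : ℕ → ℕ) (n : ℕ) : ZQ :=
  q ^ e n * (qPochInf (q ^ (2 * n + 1)) (q ^ 2) * qPochInf (q ^ (n + 1)) q) *
    recip (qPochInf (z * q ^ n) q * qPochInf (zInv * q ^ n) q)

theorem dvd_tsum_sub_sum {f : ℕ → ZQ} (hf : ∀ k, q ^ (k + 1) ∣ f k) (N : ℕ) :
    q ^ (N + 1) ∣ ∑' k, f k - ∑ k ∈ Finset.range N, f k := by
  have hd (k : ℕ) : q ^ (N + 1) ∣ f (k + N) := (pow_dvd_pow q (by omega)).trans (hf (k + N))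
  have hs : Summable fun k => f (k + N) :=
    summable_of_dvd fun k => (pow_dvd_pow q (by omega)).trans (hf (k + N))
  rw [← hs.sum_add_tsum_nat_add', add_sub_cancel_left]
  exact dvd_tsum hs hd

theorem sptSeries_eq_tsum (e : ℕ → ℕ) : sptSeries e = ∑' k, sptTerm e (k + 1) := by
  simp only [sptSeries, sptTerm]

theorem dvd_sptSeries_sub {e : ℕ → ℕ} (he : ∀ n, n ≤ e n) (N : ℕ) :
    q ^ (N + 1) ∣ sptSeries e - ∑ n ∈ Finset.range N, sptTerm e (n + 1) := by
  rw [sptSeries_eq_tsum]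
  exact dvd_tsum_sub_sum
    (fun k => ((pow_dvd_pow q (he (k + 1))).mul_right _).mul_right _) N

/-- Since `(q;q²)_∞ (q²;q²)_∞ = (q;q)_∞`, the extra factor completes the prefactor to `(q;q)_∞²`. -/
theorem qPochInf_mul_sptTerm (e : ℕ → ℕ) (n : ℕ) :
    qPochInf (q ^ 2) (q ^ 2) * sptTerm e n =
      q ^ e n * (invOddFactorial n * invFactorial n) * crankTail n := by
  rw [sptTerm, crankTail, ← qPochInf_mul_invFactorial, ← qPochInf_mul_invOddFactorial,
    sq (qPochInf q q)]
  nth_rw 3 [← qPochInf_odd_mul_even]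
  ring

/-- The expansion in partial fractions that Bailey's lemma gives for `sptSeries e`, in truncated
form. -/
noncomputable def baileySide (A : ℕ → ZQ) (M : ℕ) : ZQ :=
  ∑ r ∈ Finset.range M, A (r + 1) * (q ^ (2 * (r + 1)) * poleTerm (2 * (r + 1))) -
    ∑ r ∈ Finset.range (2 * M), unitAlpha q (r + 1) * (q ^ (r + 1) * poleTerm (r + 1))

theorem dvd_sptSeries_sub_baileySide {e : ℕ → ℕ} (he : ∀ n, n ≤ e n) {A : ℕ → ZQ} (hA : A 0 = 1)
    (M : ℕ)
    (h : ∀ n ≤ 2 * M, q ^ e n * (invOddFactorial n * invFactorial n) = q ^ n *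
      ∑ r ∈ Finset.range (M + 1),
        A r * (shiftBy invFactorial n (2 * r) * invFactorial (n + 2 * r))) :
    q ^ (2 * M + 1) ∣ qPochInf (q ^ 2) (q ^ 2) * sptSeries e - baileySide A M := by
  set G : ℕ → ZQ := fun r => ∑ n ∈ Finset.range (2 * M), q ^ (n + 1) * crankTail (n + 1) *
        (shiftBy invFactorial (n + 1) r * invFactorial (n + 1 + r)) with hG
  have hterm : ∀ n ∈ Finset.range (2 * M), qPochInf (q ^ 2) (q ^ 2) * sptTerm e (n + 1) =
      ∑ r ∈ Finset.range M, A (r + 1) * (q ^ (n + 1) * crankTail (n + 1) *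
        (shiftBy invFactorial (n + 1) (2 * (r + 1)) * invFactorial (n + 1 + 2 * (r + 1)))) -
      ∑ r ∈ Finset.range (2 * M), unitAlpha q (r + 1) * (q ^ (n + 1) * crankTail (n + 1) *
        (shiftBy invFactorial (n + 1) (r + 1) * invFactorial (n + 1 + (r + 1)))) := by
    intro n hn
    have hn' := Finset.mem_range.mp hn
    -- As `n + 1 ≥ 1`, the unit pair sums to zero; subtracting it cancels the `r = 0` term, because
    -- both sequences start with `1`.
    have hu := unitAlpha_sum isInvFactorial_invFactorial isUnit_one_sub_q_pow
      (n := n + 1) (N := 2 * M) (by omega) (by omega)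
    rw [qPochInf_mul_sptTerm, h (n + 1) (by omega), Finset.sum_range_succ', hA]
    rw [Finset.sum_range_succ', show unitAlpha q 0 = 1 by simp [unitAlpha]] at hu
    simp_rw [mul_left_comm _ (q ^ (n + 1) * crankTail (n + 1)), ← Finset.mul_sum]
    simp only [mul_zero, add_zero] at hu ⊢
    linear_combination (q ^ (n + 1) * crankTail (n + 1)) * hu
  have hsum : qPochInf (q ^ 2) (q ^ 2) * ∑ n ∈ Finset.range (2 * M), sptTerm e (n + 1) =
      ∑ r ∈ Finset.range M, A (r + 1) * G (2 * (r + 1)) -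
        ∑ r ∈ Finset.range (2 * M), unitAlpha q (r + 1) * G (r + 1) := by
    rw [Finset.mul_sum, Finset.sum_congr rfl hterm, Finset.sum_sub_distrib, Finset.sum_comm,
      Finset.sum_comm (s := Finset.range (2 * M)) (t := Finset.range (2 * M))]
    simp only [hG, Finset.mul_sum]
  have hmain : q ^ (2 * M + 1) ∣
      qPochInf (q ^ 2) (q ^ 2) * ∑ n ∈ Finset.range (2 * M), sptTerm e (n + 1) -
        baileySide A M := by
    rw [hsum, baileySide, sub_sub_sub_comm, ← Finset.sum_sub_distrib, ← Finset.sum_sub_distrib]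
    refine dvd_sub (Finset.dvd_sum fun r hr => ?_) (Finset.dvd_sum fun r hr => ?_)
    all_goals
      rw [← mul_sub]
      have := Finset.mem_range.mp hr
      exact (dvd_sum_crankTail_sub (by omega) (by omega)).mul_left _
  convert dvd_add ((dvd_sptSeries_sub he (2 * M)).mul_left (qPochInf (q ^ 2) (q ^ 2))) hmain using 1
  ring

theorem dvd_SC1_sub (M : ℕ) :
    q ^ (2 * M + 1) ∣ qPochInf (q ^ 2) (q ^ 2) * SC1 - baileySide (cOneAlpha q) M :=
  dvd_sptSeries_sub_baileySide (fun _ => le_rfl) (by simp [cOneAlpha]) M fun n hn => by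
    rw [cOneAlpha_sum isInvFactorial_invFactorial isInvOddFactorial_invOddFactorial
      isUnit_one_sub_q_pow M hn]

theorem half_mul_succ (n : ℕ) : n * (n + 1) / 2 = n + n * (n - 1) / 2 := by
  rcases n with _ | n
  · rfl
  · rw [Nat.add_sub_cancel, show (n + 1) * (n + 1 + 1) = (n + 1) * n + (n + 1) * 2 by ring,
      Nat.add_mul_div_right _ _ two_pos, add_comm]

theorem dvd_SC5_sub (M : ℕ) :
    q ^ (2 * M + 1) ∣ qPochInf (q ^ 2) (q ^ 2) * SC5 - baileySide (cFiveAlpha q) M :=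
  dvd_sptSeries_sub_baileySide (fun n => by rw [half_mul_succ]; omega) (by simp [cFiveAlpha]) M
    fun n hn => by
      rw [cFiveAlpha_sum isInvFactorial_invFactorial isInvOddFactorial_invOddFactorial
        isUnit_one_sub_q_pow M hn, half_mul_succ, pow_add, mul_assoc]

/-! ### Extraction of the coefficient of `z^m` -/

/-- The coefficient of `z ^ m`, as a power series in `q`. -/
noncomputable def zCoeff (m : ℤ) : ZQ →+ PowerSeries ℤ where
  toFun f := PowerSeries.mk fun n => (PowerSeries.coeff n f).coeff m
  map_zero' := by ext; simp
  map_add' f g := by ext; simp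

theorem coeff_zCoeff (m : ℤ) (f : ZQ) (n : ℕ) :
    PowerSeries.coeff n (zCoeff m f) = (PowerSeries.coeff n f).coeff m := by
  simp [zCoeff]

/-- Power series in `q` alone, inside `ℤ[z, z⁻¹]⟦q⟧`. -/
noncomputable def ofInt : PowerSeries ℤ →+* ZQ := PowerSeries.map LaurentPolynomial.C

theorem ofInt_X : ofInt PowerSeries.X = q := PowerSeries.map_X _

theorem zCoeff_ofInt_mul (m : ℤ) (g : PowerSeries ℤ) (f : ZQ) :
    zCoeff m (ofInt g * f) = g * zCoeff m f := by
  ext n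
  rw [coeff_zCoeff, PowerSeries.coeff_mul, PowerSeries.coeff_mul, AddMonoidAlgebra.coeff_sum,
    Finsupp.finsetSum_apply]
  refine Finset.sum_congr rfl fun p _ => ?_
  rw [coeff_zCoeff, ofInt, PowerSeries.coeff_map, ← LaurentPolynomial.smul_eq_C_mul,
    AddMonoidAlgebra.coeff_smul, Finsupp.smul_apply, smul_eq_mul]

/-- The geometric series `1 / (1 - X ^ d)`. -/
noncomputable def geom (d : ℕ) : PowerSeries ℤ := PowerSeries.mk fun n => if d ∣ n then 1 else 0

theorem one_sub_mul_mk_eq_one {A : Type*} [CommRing A] (u : ℕ → A) (a : A) (hu : u 0 = 1)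
    (ha : ∀ k, u (k + 1) = a * u k) {d : ℕ} (hd : 1 ≤ d) :
    (1 - PowerSeries.C a * PowerSeries.X ^ d) *
      PowerSeries.mk (fun n => if d ∣ n then u (n / d) else 0) = 1 := by
  ext n
  rw [sub_mul, one_mul, mul_assoc, map_sub, PowerSeries.coeff_C_mul,
    PowerSeries.coeff_X_pow_mul', PowerSeries.coeff_mk, PowerSeries.coeff_one]
  rcases Nat.eq_zero_or_pos n with rfl | hn
  · simp [hu, show d = 0 ↔ False by simp; omega]
  rw [if_neg hn.ne']
  by_cases hdn : d ∣ n
  · obtain ⟨c, rfl⟩ := hdn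
    rcases c with _ | c
    · simp at hn
    rw [if_pos (Dvd.intro _ rfl), if_pos (Nat.le_mul_of_pos_right d c.succ_pos),
      PowerSeries.coeff_mk, show d * (c + 1) - d = d * c by rw [mul_add, mul_one]; omega,
      if_pos (Dvd.intro _ rfl), Nat.mul_div_cancel_left _ hd, Nat.mul_div_cancel_left _ hd, ha,
      sub_self]
  · rw [if_neg hdn]
    split_ifs with h
    · rw [PowerSeries.coeff_mk, if_neg fun h' => hdn ((Nat.dvd_sub_iff_left h dvd_rfl).mp h')]
      simp
    · simp

theorem one_sub_mul_geom {d : ℕ} (hd : 1 ≤ d) : (1 - PowerSeries.X ^ d) * geom d = 1 := by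
  simpa [geom] using one_sub_mul_mk_eq_one (fun _ => (1 : ℤ)) 1 rfl (by simp) hd

/-- The geometric series `1 / (1 - z ^ u q ^ r)`. -/
noncomputable def geomT (u : ℤ) (r : ℕ) : ZQ :=
  PowerSeries.mk fun n => if r ∣ n then LaurentPolynomial.T (u * (n / r : ℕ)) else 0

theorem one_sub_mul_geomT (u : ℤ) {r : ℕ} (hr : 1 ≤ r) :
    (1 - PowerSeries.C (LaurentPolynomial.T u) * q ^ r) * geomT u r = 1 :=
  one_sub_mul_mk_eq_one (fun k => LaurentPolynomial.T (u * (k : ℕ))) _ (by simp)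
    (fun k => by rw [← LaurentPolynomial.T_add]; congr 1; push_cast; ring) hr

theorem zCoeff_geomT_add (m : ℤ) {r : ℕ} (hr : 1 ≤ r) :
    zCoeff m (geomT 1 r + geomT (-1) r - 1) = PowerSeries.X ^ (r * m.natAbs) := by
  ext n
  rw [coeff_zCoeff, map_sub, map_add, PowerSeries.coeff_X_pow, geomT, geomT, PowerSeries.coeff_mk,
    PowerSeries.coeff_mk, PowerSeries.coeff_one, AddMonoidAlgebra.coeff_sub,
    AddMonoidAlgebra.coeff_add, Finsupp.sub_apply, Finsupp.add_apply]
  by_cases hdn : r ∣ n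
  · obtain ⟨c, rfl⟩ := hdn
    have hrc : r * c = 0 ↔ c = 0 := by simp; omega
    have hrm : r * c = r * m.natAbs ↔ c = m.natAbs := by
      rw [Nat.mul_right_inj (by omega)]
    rw [if_pos (Dvd.intro _ rfl), if_pos (Dvd.intro _ rfl), Nat.mul_div_cancel_left _ hr]
    simp only [hrc, hrm, LaurentPolynomial.T_apply]
    rw [← LaurentPolynomial.T_zero]
    by_cases hc : c = 0
    · simp only [hc, if_true, LaurentPolynomial.T_apply]
      split_ifs <;> first | rfl | omega
    · simp only [hc, if_false, AddMonoidAlgebra.coeff_zero, Finsupp.zero_apply]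
      split_ifs <;> first | rfl | omega
  · have h1 : n ≠ 0 := by rintro rfl; simp at hdn
    have h2 : n ≠ r * m.natAbs := by rintro rfl; simp at hdn
    simp [hdn, h1, h2]

/-- Partial fractions: `(1 - q^(2r)) / ((1 - z q^r)(1 - z⁻¹ q^r)) = 1/(1 - z q^r) + 1/(1 - z⁻¹ q^r)
- 1`, which is `∑_m z^m q^(r|m|)`. -/
theorem zCoeff_poleTerm (m : ℤ) {r : ℕ} (hr : 1 ≤ r) :
    zCoeff m ((1 + q ^ r) * poleTerm r) = PowerSeries.X ^ (r * m.natAbs) * geom r := by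
  have h1 : (1 - z * q ^ r) * geomT 1 r = 1 := one_sub_mul_geomT 1 hr
  have h2 : (1 - zInv * q ^ r) * geomT (-1) r = 1 := one_sub_mul_geomT (-1) hr
  have h3 : ofInt (1 - PowerSeries.X ^ r) * ((1 + q ^ r) * poleTerm r) =
      geomT 1 r + geomT (-1) r - 1 := by
    have hp := mul_poleTerm hr
    have hpg : poleTerm r = geomT 1 r * geomT (-1) r := by
      linear_combination (geomT 1 r * geomT (-1) r) * hp -
        poleTerm r * ((1 - zInv * q ^ r) * geomT (-1) r) * h1 - poleTerm r * h2
    rw [map_sub, map_one, map_pow, ofInt_X, hpg]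
    linear_combination geomT (-1) r * h1 + geomT 1 r * h2 -
      (1 - zInv * q ^ r) * geomT (-1) r * h1 - h2 +
        q ^ (2 * r) * geomT 1 r * geomT (-1) r * z_mul_zInv
  have h4 := zCoeff_ofInt_mul m (1 - PowerSeries.X ^ r) ((1 + q ^ r) * poleTerm r)
  rw [h3, zCoeff_geomT_add m hr] at h4
  linear_combination (-geom r) * h4 + (-zCoeff m ((1 + q ^ r) * poleTerm r)) * one_sub_mul_geom hr

/-! ### Nonnegative power series and geometric series -/

/-- Nonnegativity of all coefficients. -/
def Nonneg (f : PowerSeries ℤ) : Prop := ∀ n, 0 ≤ PowerSeries.coeff n f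

theorem Nonneg.add {f g : PowerSeries ℤ} (hf : Nonneg f) (hg : Nonneg g) : Nonneg (f + g) :=
  fun n => by rw [map_add]; exact add_nonneg (hf n) (hg n)

theorem Nonneg.mul {f g : PowerSeries ℤ} (hf : Nonneg f) (hg : Nonneg g) : Nonneg (f * g) :=
  fun n => by
    rw [PowerSeries.coeff_mul]
    exact Finset.sum_nonneg fun p _ => mul_nonneg (hf _) (hg _)

theorem nonneg_X_pow (k : ℕ) : Nonneg (PowerSeries.X ^ k) := fun n => by
  rw [PowerSeries.coeff_X_pow]; split_ifs <;> simp

theorem nonneg_one : Nonneg 1 := by simpa using nonneg_X_pow 0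

theorem Nonneg.sum {ι : Type*} {s : Finset ι} {f : ι → PowerSeries ℤ}
    (h : ∀ i ∈ s, Nonneg (f i)) : Nonneg (∑ i ∈ s, f i) := fun n => by
  rw [map_sum]
  exact Finset.sum_nonneg fun i hi => h i hi n

theorem Nonneg.prod {ι : Type*} {s : Finset ι} {f : ι → PowerSeries ℤ}
    (h : ∀ i ∈ s, Nonneg (f i)) : Nonneg (∏ i ∈ s, f i) :=
  Finset.prod_induction _ Nonneg (fun _ _ => Nonneg.mul) nonneg_one h

theorem nonneg_geom (d : ℕ) : Nonneg (geom d) := fun n => by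
  rw [geom, PowerSeries.coeff_mk]; split_ifs <;> simp

theorem sum_X_pow_eq {d : ℕ} (hd : 1 ≤ d) (a t : ℕ) :
    ∑ j ∈ Finset.range t, (PowerSeries.X : PowerSeries ℤ) ^ (a + d * j) =
      PowerSeries.X ^ a * geom d - PowerSeries.X ^ (a + d * t) * geom d := by
  induction t with
  | zero => simp
  | succ t ih =>
    rw [Finset.sum_range_succ, ih]
    linear_combination (-PowerSeries.X ^ (a + d * t)) * one_sub_mul_geom hd

theorem geom_eq_add {d : ℕ} (hd : 1 ≤ d) :
    geom d = geom (2 * d) + PowerSeries.X ^ d * geom (2 * d) := by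
  have h1 := one_sub_mul_geom hd
  have h2 := one_sub_mul_geom (show 1 ≤ 2 * d by omega)
  linear_combination (geom (2 * d) + PowerSeries.X ^ d * geom (2 * d)) * h1 - geom d * h2

/-- The product `∏_{1 ≤ j ≤ N} 1 / (1 - X ^ (2 j))`. -/
noncomputable def evenPartitions (N : ℕ) : PowerSeries ℤ :=
  ∏ j ∈ Finset.range N, geom (2 * (j + 1))

theorem nonneg_evenPartitions (N : ℕ) : Nonneg (evenPartitions N) :=
  Nonneg.prod fun _ _ => nonneg_geom _

/-- The difference is `1 - X²` times a sum of monomials, and the index `N + 1` guarantees the factor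
`1/(1 - X²)` that cancels it. -/
theorem nonneg_X_pow_sub_mul_evenPartitions (N : ℕ) {a b : ℕ} (hab : a ≤ b) :
    Nonneg ((PowerSeries.X ^ (2 * a) - PowerSeries.X ^ (2 * b)) * evenPartitions (N + 1)) := by
  obtain ⟨c, rfl⟩ := Nat.exists_eq_add_of_le hab
  have h : (PowerSeries.X ^ (2 * a) - PowerSeries.X ^ (2 * (a + c))) * evenPartitions (N + 1) =
      (∑ j ∈ Finset.range c, PowerSeries.X ^ (2 * a + 2 * j)) *
        ∏ j ∈ Finset.range N, geom (2 * (j + 1 + 1)) := by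
    rw [evenPartitions, Finset.prod_range_succ', sum_X_pow_eq (by omega) (2 * a) c]
    ring
  rw [h]
  exact (Nonneg.sum fun _ _ => nonneg_X_pow _).mul (Nonneg.prod fun _ _ => nonneg_geom _)

theorem qPoch_mul_evenPartitions (N : ℕ) :
    qPoch (q ^ 2) (q ^ 2) N * ofInt (evenPartitions N) = 1 := by
  rw [qPoch, evenPartitions, map_prod, ← Finset.prod_mul_distrib]
  refine Finset.prod_eq_one fun j _ => ?_
  have := congrArg ofInt (one_sub_mul_geom (show 1 ≤ 2 * (j + 1) by omega))
  rw [map_mul, map_sub, map_pow, map_one, ofInt_X] at this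
  linear_combination this

theorem zCoeff_neg_one_pow_mul (m : ℤ) (s e : ℕ) {r : ℕ} (hr : 1 ≤ r) :
    zCoeff m ((-1) ^ s * q ^ e * (1 + q ^ r) * (q ^ r * poleTerm r)) =
      (-1) ^ s * PowerSeries.X ^ (e + r + r * m.natAbs) * geom r := by
  have : (-1) ^ s * q ^ e * (1 + q ^ r) * (q ^ r * poleTerm r) =
      ofInt ((-1) ^ s * PowerSeries.X ^ (e + r)) * ((1 + q ^ r) * poleTerm r) := by
    rw [map_mul, map_pow, map_pow, map_neg, map_one, ofInt_X]
    ring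
  rw [this, zCoeff_ofInt_mul, zCoeff_poleTerm m hr]
  ring

/-! ### The signed terms of the `z^m` coefficient -/

/-- The contribution of `r + 1` to the `z ^ k` coefficient of the crank part. -/
noncomputable def crankTerm (k r : ℕ) : PowerSeries ℤ :=
  (-1) ^ r * PowerSeries.X ^ ((r + 1) * r / 2 + (r + 1) + (r + 1) * k) * geom (r + 1)

theorem zCoeff_crankTerm (m : ℤ) (r : ℕ) :
    zCoeff m (unitAlpha q (r + 1) * (q ^ (r + 1) * poleTerm (r + 1))) =
      -crankTerm m.natAbs r := by
  rw [unitAlpha, if_neg r.succ_ne_zero, zCoeff_neg_one_pow_mul m _ _ (by omega), crankTerm,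
    Nat.add_sub_cancel]
  ring

/-- The contribution of `r + 1` to the `z ^ k` coefficient of the rank part, with base `q²`. -/
noncomputable def rankTerm (k r : ℕ) : PowerSeries ℤ :=
  (-1) ^ (r + 1) * PowerSeries.X ^ ((r + 1) * (3 * r + 4 + 2 * k)) * geom (2 * (r + 1))

theorem zCoeff_rankTerm (m : ℤ) (r : ℕ) :
    zCoeff m (cOneAlpha q (r + 1) * (q ^ (2 * (r + 1)) * poleTerm (2 * (r + 1)))) =
      rankTerm m.natAbs r := by
  rw [cOneAlpha, if_neg r.succ_ne_zero, zCoeff_neg_one_pow_mul m _ _ (by omega), rankTerm,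
    show 3 * (r + 1) - 1 = 3 * r + 2 by omega]
  congr 3
  ring

/-- The contribution of `r + 1` to the `z ^ k` coefficient of the crank part with base `q²`. -/
noncomputable def sqCrankTerm (k r : ℕ) : PowerSeries ℤ :=
  (-1) ^ (r + 1) * PowerSeries.X ^ ((r + 1) * (r + 2 + 2 * k)) * geom (2 * (r + 1))

theorem zCoeff_sqCrankTerm (m : ℤ) (r : ℕ) :
    zCoeff m (cFiveAlpha q (r + 1) * (q ^ (2 * (r + 1)) * poleTerm (2 * (r + 1)))) =
      sqCrankTerm m.natAbs r := by
  rw [cFiveAlpha, if_neg r.succ_ne_zero, zCoeff_neg_one_pow_mul m _ _ (by omega), sqCrankTerm,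
    Nat.add_sub_cancel]
  congr 3
  ring

theorem zCoeff_baileySide (m : ℤ) {A : ℕ → ZQ} {v : ℕ → PowerSeries ℤ} (M : ℕ)
    (hv : ∀ r, zCoeff m (A (r + 1) * (q ^ (2 * (r + 1)) * poleTerm (2 * (r + 1)))) = v r) :
    zCoeff m (baileySide A M) =
      ∑ r ∈ Finset.range M, v r + ∑ r ∈ Finset.range (2 * M), crankTerm m.natAbs r := by
  rw [baileySide, map_sub, map_sum, map_sum]
  simp only [hv, zCoeff_crankTerm, Finset.sum_neg_distrib, sub_neg_eq_add]

/-! ### Grouping and cancellation -/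

theorem sum_range_two_mul {B : Type*} [AddCommMonoid B] (f : ℕ → B) (n : ℕ) :
    ∑ r ∈ Finset.range (2 * n), f r = ∑ l ∈ Finset.range n, (f (2 * l) + f (2 * l + 1)) := by
  induction n with
  | zero => simp
  | succ n ih =>
    rw [show 2 * (n + 1) = 2 * n + 1 + 1 by ring, Finset.sum_range_succ, Finset.sum_range_succ, ih,
      Finset.sum_range_succ, add_assoc]

theorem crankTerm_two_mul (k l : ℕ) :
    crankTerm k (2 * l) = PowerSeries.X ^ ((2 * l + 1) * (l + 1 + k)) * geom (2 * l + 1) := by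
  rw [crankTerm, show (2 * l + 1) * (2 * l) = (2 * l + 1) * l * 2 by ring,
    Nat.mul_div_cancel _ two_pos, (even_two_mul l).neg_one_pow]
  ring

theorem crankTerm_two_mul_add_one (k l : ℕ) : crankTerm k (2 * l + 1) =
    -(PowerSeries.X ^ ((l + 1) * (2 * l + 3 + 2 * k)) * geom (2 * (l + 1))) := by
  rw [crankTerm, show (2 * l + 1 + 1) * (2 * l + 1) = (l + 1) * (2 * l + 1) * 2 by ring,
    Nat.mul_div_cancel _ two_pos, (odd_two_mul_add_one l).neg_one_pow,
    show 2 * l + 1 + 1 = 2 * (l + 1) by ring]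
  ring

/-- For crank terms `u`, even indices are positive and odd ones negative. Each group takes one
even-indexed and two odd-indexed crank terms, so exactly the even-indexed ones from `2L` on are left
over, and these are harmless. -/
theorem sum_regroup {B : Type*} [AddCommMonoid B] (u v : ℕ → B) (L : ℕ) :
    ∑ r ∈ Finset.range (2 * L), v r + ∑ r ∈ Finset.range (2 * (2 * L)), u r =
      ∑ l ∈ Finset.range L, (u (2 * l) + u (2 * (2 * l) + 1) + u (2 * (2 * l + 1) + 1) +
        (v (2 * l) + v (2 * l + 1))) + ∑ l ∈ Finset.range L, u (2 * (L + l)) := by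
  rw [sum_range_two_mul v, sum_range_two_mul u, Finset.sum_add_distrib (s := Finset.range (2 * L)),
    sum_range_two_mul fun l => u (2 * l + 1), two_mul L, Finset.sum_range_add]
  simp only [Finset.sum_add_distrib]
  abel

/-- Of the consecutive integers `l + 1 + k` and `l + 2 + k` one is even and one is odd; the floors
select them without a case distinction. The odd half will absorb `crankTerm k (4l + 1)`, the even
half the negative term `v (2l)`. -/
theorem crankTerm_even_split (k l : ℕ) : crankTerm k (2 * l) =
    PowerSeries.X ^ ((2 * l + 1) * (2 * ((l + 1 + k + 1) / 2))) * geom (2 * (2 * l + 1)) +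
      PowerSeries.X ^ ((2 * l + 1) * (2 * ((l + 1 + k) / 2) + 1)) * geom (2 * (2 * l + 1)) := by
  rw [crankTerm_two_mul, geom_eq_add (by omega : 1 ≤ 2 * l + 1)]
  rcases Nat.even_or_odd' (l + 1 + k) with ⟨c, hc | hc⟩
  · rw [hc, show (2 * c + 1) / 2 = c by omega, show 2 * c / 2 = c by omega]
    ring
  · rw [hc, show (2 * c + 1 + 1) / 2 = c + 1 by omega, show (2 * c + 1) / 2 = c by omega]
    ring

/-- The terms of `crankTerm` with indices `2 l` and `4 l + 1` cancel up to two finite sums. -/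
theorem crankTerm_add_crankTerm (k l : ℕ) :
    crankTerm k (2 * l) + crankTerm k (2 * (2 * l) + 1) =
      PowerSeries.X ^ ((2 * l + 1) * (2 * ((l + 1 + k + 1) / 2))) * geom (2 * (2 * l + 1)) +
      ∑ j ∈ Finset.range (2 * l + 1 + k - (l + 1 + k) / 2),
        PowerSeries.X ^ ((2 * l + 1) * (2 * ((l + 1 + k) / 2) + 1) + 2 * (2 * l + 1) * j) := by
  rw [crankTerm_even_split, crankTerm_two_mul_add_one, sum_X_pow_eq (by omega)]
  have : (2 * l + 1) * (2 * (2 * l) + 3 + 2 * k) = (2 * l + 1) * (2 * ((l + 1 + k) / 2) + 1) +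
      2 * (2 * l + 1) * (2 * l + 1 + k - (l + 1 + k) / 2) := by
    obtain ⟨t, ht⟩ := Nat.exists_eq_add_of_le (show (l + 1 + k) / 2 ≤ 2 * l + 1 + k by omega)
    rw [ht, Nat.add_sub_cancel_left]
    generalize (l + 1 + k) / 2 = c at *
    have : 2 * (2 * l) + 3 + 2 * k = 2 * c + 1 + 2 * t := by omega
    rw [this]; ring
  rw [this]
  ring

theorem nonneg_group_sqCrank (k l : ℕ) :
    Nonneg (crankTerm k (2 * l) + crankTerm k (2 * (2 * l) + 1) +
      crankTerm k (2 * (2 * l + 1) + 1) +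
        (sqCrankTerm k (2 * l) + sqCrankTerm k (2 * l + 1))) := by
  set b := (l + 1 + k + 1) / 2 with hb
  set n := 2 * l + 1 with hn
  have h1 : sqCrankTerm k (2 * l) =
      -(PowerSeries.X ^ (n * (2 * b) + 2 * n * (l + 1 + k - b)) * geom (2 * n)) := by
    obtain ⟨t, ht⟩ := Nat.exists_eq_add_of_le (show b ≤ l + 1 + k by omega)
    rw [ht, Nat.add_sub_cancel_left, sqCrankTerm, (odd_two_mul_add_one l).neg_one_pow, ← hn,
      show 2 * l + 2 + 2 * k = 2 * b + 2 * t by omega]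
    ring
  have h2 : crankTerm k (2 * (2 * l + 1) + 1) + sqCrankTerm k (2 * l + 1) =
      ∑ j ∈ Finset.range (l + 1),
        PowerSeries.X ^ ((2 * l + 2) * (2 * l + 3 + 2 * k) + 4 * (l + 1) * j) := by
    rw [sum_X_pow_eq (by omega), crankTerm_two_mul_add_one, sqCrankTerm,
      Even.neg_one_pow ⟨l + 1, by ring⟩,
      show 2 * (2 * l + 1 + 1) = 4 * (l + 1) by ring]
    ring
  have h3 := crankTerm_add_crankTerm k l
  rw [← hb, ← hn] at h3
  have h4 := sum_X_pow_eq (show 1 ≤ 2 * n by omega) (n * (2 * b)) (l + 1 + k - b)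
  have key : crankTerm k (2 * l) + crankTerm k (2 * (2 * l) + 1) +
      crankTerm k (2 * (2 * l + 1) + 1) + (sqCrankTerm k (2 * l) + sqCrankTerm k (2 * l + 1)) =
      ∑ j ∈ Finset.range (l + 1 + k - b), PowerSeries.X ^ (n * (2 * b) + 2 * n * j) +
      ∑ j ∈ Finset.range (n + k - (l + 1 + k) / 2),
        PowerSeries.X ^ (n * (2 * ((l + 1 + k) / 2) + 1) + 2 * n * j) +
      ∑ j ∈ Finset.range (l + 1),
        PowerSeries.X ^ ((2 * l + 2) * (2 * l + 3 + 2 * k) + 4 * (l + 1) * j) := by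
    rw [← h2, h4]
    linear_combination h3 + h1
  rw [key]
  exact ((Nonneg.sum fun _ _ => nonneg_X_pow _).add (Nonneg.sum fun _ _ => nonneg_X_pow _)).add
    (Nonneg.sum fun _ _ => nonneg_X_pow _)

theorem nonneg_group_rank (N k l : ℕ) :
    Nonneg ((crankTerm k (2 * l) + crankTerm k (2 * (2 * l) + 1) +
      crankTerm k (2 * (2 * l + 1) + 1) +
        (rankTerm k (2 * l) + rankTerm k (2 * l + 1))) * evenPartitions (N + 1)) := by
  set b := (l + 1 + k + 1) / 2 with hb
  set n := 2 * l + 1 with hn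
  -- The even half minus the rank term is a sum of `l + 1 + s` monomials; the first `l + 1` are
  -- reserved to offset the `l + 1` negative monomials of `h2`.
  obtain ⟨s, hs⟩ := Nat.exists_eq_add_of_le (show b + (l + 1) ≤ 3 * l + 2 + k by omega)
  have h1 : rankTerm k (2 * l) =
      -(PowerSeries.X ^ (n * (2 * b) + 2 * n * (l + 1 + s)) * geom (2 * n)) := by
    rw [rankTerm, (odd_two_mul_add_one l).neg_one_pow, ← hn,
      show 3 * (2 * l) + 4 + 2 * k = 2 * b + 2 * (l + 1 + s) by omega]
    ring
  have h2 : crankTerm k (2 * (2 * l + 1) + 1) + rankTerm k (2 * l + 1) =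
      -∑ j ∈ Finset.range (l + 1),
        PowerSeries.X ^ ((2 * l + 2) * (4 * l + 5 + 2 * k) + 4 * (l + 1) * j) := by
    rw [sum_X_pow_eq (by omega), crankTerm_two_mul_add_one, rankTerm,
      Even.neg_one_pow ⟨l + 1, by ring⟩,
      show 2 * (2 * l + 1 + 1) = 4 * (l + 1) by ring]
    ring
  have h3 := crankTerm_add_crankTerm k l
  rw [← hb, ← hn] at h3
  have h4 := sum_X_pow_eq (show 1 ≤ 2 * n by omega) (n * (2 * b)) (l + 1 + s)
  rw [Finset.sum_range_add] at h4
  have key : crankTerm k (2 * l) + crankTerm k (2 * (2 * l) + 1) +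
      crankTerm k (2 * (2 * l + 1) + 1) + (rankTerm k (2 * l) + rankTerm k (2 * l + 1)) =
      ∑ j ∈ Finset.range s, PowerSeries.X ^ (n * (2 * b) + 2 * n * (l + 1 + j)) +
      ∑ j ∈ Finset.range (n + k - (l + 1 + k) / 2),
        PowerSeries.X ^ (n * (2 * ((l + 1 + k) / 2) + 1) + 2 * n * j) +
      ∑ j ∈ Finset.range (l + 1), (PowerSeries.X ^ (2 * (n * b + n * j)) -
        PowerSeries.X ^ (2 * ((l + 1) * (4 * l + 5 + 2 * k) + 2 * (l + 1) * j))) := by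
    have e1 (j : ℕ) : 2 * (n * b + n * j) = n * (2 * b) + 2 * n * j := by ring
    have e2 (j : ℕ) : 2 * ((l + 1) * (4 * l + 5 + 2 * k) + 2 * (l + 1) * j) =
        (2 * l + 2) * (4 * l + 5 + 2 * k) + 4 * (l + 1) * j := by ring
    simp only [Finset.sum_sub_distrib, e1, e2]
    linear_combination h3 + h1 + h2 - h4
  rw [key, add_mul]
  refine Nonneg.add (((Nonneg.sum fun _ _ => nonneg_X_pow _).add
    (Nonneg.sum fun _ _ => nonneg_X_pow _)).mul (nonneg_evenPartitions _)) ?_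
  rw [Finset.sum_mul]
  refine Nonneg.sum fun j _ => nonneg_X_pow_sub_mul_evenPartitions N ?_
  -- What remains is the exponent comparison `n b + n j ≤ (l+1)(4l+5+2k) + 2(l+1) j`, using `n ≤
  -- 2(l+1)` and `2b ≤ 4l+5+2k`.
  have hbn : b ≤ 4 * l + 5 + 2 * k := by omega
  have : n * b ≤ (2 * (l + 1)) * b := Nat.mul_le_mul_right _ (by omega)
  have : (l + 1) * (2 * b) ≤ (l + 1) * (4 * l + 5 + 2 * k) := Nat.mul_le_mul_left _ (by omega)
  have : n * j ≤ 2 * (l + 1) * j := Nat.mul_le_mul_right _ (by omega)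
  linarith

theorem nonneg_crankTerm_two_mul (k l : ℕ) : Nonneg (crankTerm k (2 * l)) := by
  rw [crankTerm_two_mul]
  exact (nonneg_X_pow _).mul (nonneg_geom _)

/-! ### Assembly -/

theorem nonneg_zCoeff_baileySide_mul (m : ℤ) {A : ℕ → ZQ} {v : ℕ → PowerSeries ℤ} (L N : ℕ)
    (hv : ∀ r, zCoeff m (A (r + 1) * (q ^ (2 * (r + 1)) * poleTerm (2 * (r + 1)))) = v r)
    (hpos : ∀ l, Nonneg ((crankTerm m.natAbs (2 * l) + crankTerm m.natAbs (2 * (2 * l) + 1) +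
      crankTerm m.natAbs (2 * (2 * l + 1) + 1) + (v (2 * l) + v (2 * l + 1))) *
        evenPartitions (N + 1))) :
    Nonneg (zCoeff m (baileySide A (2 * L)) * evenPartitions (N + 1)) := by
  rw [zCoeff_baileySide m _ hv, sum_regroup, add_mul, Finset.sum_mul]
  exact (Nonneg.sum fun l _ => hpos l).add
    ((Nonneg.sum fun l _ => nonneg_crankTerm_two_mul _ _).mul (nonneg_evenPartitions _))

/-- A series that agrees with the truncations of Bailey's expansion has nonnegative coefficients
as soon as the truncations do after division by `∏ (1 - q ^ (2 j))`. -/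
theorem coeff_nonneg_of_dvd {S : ZQ} {A : ℕ → ZQ} (m : ℤ) (n : ℕ)
    (hS : ∀ M, q ^ (2 * M + 1) ∣ qPochInf (q ^ 2) (q ^ 2) * S - baileySide A M)
    (hpos : ∀ L N, Nonneg (zCoeff m (baileySide A (2 * L)) * evenPartitions (N + 1))) :
    0 ≤ (PowerSeries.coeff n S).coeff m := by
  have hq2 : q ∣ q ^ 2 := dvd_pow_self q two_ne_zero
  -- The truncation index `2 * n` is even, as the grouping requires, and its precision `q^(4n+1)`
  -- exceeds the `q^(n+1)` needed.
  have h1 : q ^ (n + 1) ∣ qPochInf (q ^ 2) (q ^ 2) * S - baileySide A (2 * n) :=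
    (pow_dvd_pow q (by omega)).trans (hS (2 * n))
  have h2 := qPoch_mul_qPochInf (q ^ 2) hq2 (n + 1)
  have h3 : q ^ (n + 1) ∣ qPochInf (q ^ 2 * (q ^ 2) ^ (n + 1)) (q ^ 2) - 1 := by
    refine dvd_qPochInf_sub_one ?_ hq2
    rw [← pow_mul, ← pow_add]
    exact pow_dvd_pow q (by omega)
  have h4 := qPoch_mul_evenPartitions (n + 1)
  have h5 : q ^ (n + 1) ∣ S - ofInt (evenPartitions (n + 1)) * baileySide A (2 * n) := by
    convert dvd_sub (h1.mul_left (ofInt (evenPartitions (n + 1)))) (h3.mul_right S) using 1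
    rw [← h2]
    linear_combination (-qPochInf (q ^ 2 * (q ^ 2) ^ (n + 1)) (q ^ 2) * S) * h4
  have h6 := PowerSeries.X_pow_dvd_iff.mp h5 n (Nat.lt_succ_self n)
  rw [map_sub, sub_eq_zero] at h6
  rw [h6, ← coeff_zCoeff, zCoeff_ofInt_mul, mul_comm]
  exact hpos n n n

end SptCrank

theorem mainTheorem1 (m : ℤ) (n : ℕ) (hn : 1 ≤ n) :
    0 ≤ SptCrank.MC1 m n ∧ 0 ≤ SptCrank.MC5 m n := by
  open SptCrank in
  exact ⟨coeff_nonneg_of_dvd m n dvd_SC1_sub fun L N =>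
      nonneg_zCoeff_baileySide_mul m L N (zCoeff_rankTerm m) (nonneg_group_rank N _),
    coeff_nonneg_of_dvd m n dvd_SC5_sub fun L N =>
      nonneg_zCoeff_baileySide_mul m L N (zCoeff_sqCrankTerm m) fun l =>
        (nonneg_group_sqCrank _ l).mul (nonneg_evenPartitions _)⟩
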